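/- **Setting.** Let $N$ and $M$ be finite sets of agents and items. Every agent $i$ has a monotone submodular valuation $v_i:2^M\to\mathbb R_{\ge 0}$ with $v_i(\emptyset)=0$; write $v_i(j)=v_i(\{j\})$. Let $y^*=(y^*_{i,S})_{i\in N,S\subseteq M}$ be a feasible solution of the configuration LP, i.e. $y^*\ge 0$, $\sum_{S\ni j}\sum_{i}y^*_{i,S}=1$ for every item $j$, and $\sum_S y^*_{i,S}=1$ for every agent $i$. Call $S$ a configuration for $i$ if $y^*_{i,S}>0$, assume that all configurations are non-empty, and for each one let $\kappa^{(i)}_S\in S$ be an item maximizing $v_i(j)$ over $j\in S$ (ties broken arbitrarily). **Graph.** The bipartite multigraph $G$ on $N\cup M$ has, for each agent $i$, a *marked* edge $ij$ for every item $j$ of the form $\kappa^{(i)}_S$ with $S$ a configuration for $i$, of value $x^*_{ij}=\sum_{S:\kappa^{(i)}_S=j}y^*_{i,S}$, and an *unmarked* edge $ij$ for every item $j$ that lies in $S\setminus\{\kappa^{(i)}_S\}$ for some configuration $S$ for $i$, of value $x^*_{ij}=\sum_{S:\,j\in S\setminus\{\kappa^{(i)}_S\}}y^*_{i,S}$ (sums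 over configurations for $i$). A marked and an unmarked edge may be parallel. **Rounding algorithm.** Start with $x=x^*$. While some $x_e$ is in $(0,1)$, let $G(x)$ be the graph of the edges $e$ with $0<x_e<1$, and choose arbitrarily (possibly depending on the past) in $G(x)$ either a marked cycle $(i_1,j_1,\dots,i_k,j_k,i_{k+1}=i_1)$, that is, a simple cycle of marked edges, or a pseudo-marked path $(i_1,j_1,\dots,i_k,j_k,i_{k+1})$, $k\ge1$, that is, a walk in which $(j_1,i_2,\dots,i_k,j_k)$ is a simple path of marked edges and $i_1j_1$ and $j_ki_{k+1}$ are distinct unmarked edges. Put $$\delta_1=\min\Big\{\min_a x_{i_aj_a},\ \min_a(1-x_{j_ai_{a+1}})\Big\},\qquad \delta_2=\min\Big\{\min_a(1-x_{i_aj_a}),\ \min_a x_{j_ai_{a+1}}\Big\}.$$ With probability $\delta_2/(\delta_1+\delta_2)$, for all $a\in[k]$ decrease $x_{i_aj_a}$ by $\delta_1$ and increase $x_{j_ai_{a+1}}$ by $\delta_1$; otherwise, for all $a\in[k]$ increase $x_{i_aj_a}$ by $\delta_2$ and decrease $x_{j_ai_{a+1}}$ by $\delta_2$. When $x$ is integral,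 assign to each agent $i$ the items $j$ for which some edge $ij$ has $x_{ij}=1$. **Lemma.** Fix an agent $i$ such that $v_i(S)>0$ for every configuration $S$ for $i$, and let $T$ be the random set of items that the algorithm assigns to $i$. Then $v_i(T)>0$ almost surely, $\ln v_i(T)$ is integrable, and $$\mathbb E\big[\ln v_i(T)\big]\ \ge\ \sum_{S:\,y^*_{i,S}>0}y^*_{i,S}\ln v_i(S)-\Big(3+\frac{26}{e^3}+\ln 2\Big).$$ -/

import Mathlib

open MeasureTheory

namespace NSW

/-- Non-negative, monotone, submodular set functions on `2^M`. -/
structure MonotoneSubmodular {M : Type*} [DecidableEq M] (f : Finset M → ℝ) : Prop where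
  nonneg : ∀ S, 0 ≤ f S
  mono : ∀ S T, S ⊆ T → f S ≤ f T
  submodular : ∀ S T, f (S ∩ T) + f (S ∪ T) ≤ f S + f T

/-- Feasible solutions of the configuration LP. -/
structure ConfLPFeasible {N M : Type*} [Fintype N] [Fintype M] [DecidableEq M]
    (y : N → Finset M → ℝ) : Prop where
  item : ∀ j : M, ∑ S : Finset M with j ∈ S, ∑ i : N, y i S = 1
  agent : ∀ i : N, ∑ S : Finset M, y i S = 1
  nonneg : ∀ i S, 0 ≤ y i S

/-- `κ i S` is a most valuable item (for agent `i`) of `S`, for every configuration `S` of `i`,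
i.e. every `S` with `y i S > 0`; ties are broken arbitrarily. -/
def IsLargestItem {N M : Type*} (v : N → Finset M → ℝ) (y : N → Finset M → ℝ)
    (κ : N → Finset M → M) : Prop :=
  ∀ i S, 0 < y i S → κ i S ∈ S ∧ ∀ j ∈ S, v i {j} ≤ v i {κ i S}

/-- The large items of agent `i`. -/
def largeItems {N M : Type*} (y : N → Finset M → ℝ) (κ : N → Finset M → M) (i : N) : Set M :=
  {j | ∃ S, 0 < y i S ∧ j = κ i S}

/-- The small items of agent `i`. -/
def smallItems {N M : Type*} [DecidableEq M] (y : N → Finset M → ℝ) (κ : N → Finset M → M)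
    (i : N) : Set M :=
  {j | ∃ S, 0 < y i S ∧ j ∈ S \ {κ i S}}

/-- Potential edges of the bipartite multigraph: `(i, j, true)` is the marked edge between agent
`i` and item `j`, and `(i, j, false)` is the unmarked one. -/
abbrev Edge (N M : Type*) := N × M × Bool

/-- The edge set `E`: marked edges lead to large items, unmarked edges to small items. -/
def edgeSet {N M : Type*} [DecidableEq M] (y : N → Finset M → ℝ) (κ : N → Finset M → M) :
    Set (Edge N M) :=
  {e | (e.2.2 = true ∧ e.2.1 ∈ largeItems y κ e.1) ∨
    (e.2.2 = false ∧ e.2.1 ∈ smallItems y κ e.1)}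

/-- The fractional vector `x*`. Vectors over `E` are written as functions on all potential edges;
`x*` is zero outside `E`, and the rounding never touches these coordinates. -/
def xStar {N M : Type*} [Fintype M] [DecidableEq M] (y : N → Finset M → ℝ)
    (κ : N → Finset M → M) : Edge N M → ℝ
  | (i, j, true) => ∑ S : Finset M with κ i S = j, y i S
  | (i, j, false) => ∑ S : Finset M with j ∈ S \ {κ i S}, y i S

/-- The edges of `E` whose value is strictly fractional, i.e. the edge set of `G(x)`. -/
def fsupp {N M : Type*} (E : Set (Edge N M)) (x : Edge N M → ℝ) : Set (Edge N M) :=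
  {e | e ∈ E ∧ 0 < x e ∧ x e < 1}

/-- A walk `(i_1, j_1, i_2, j_2, …, i_k, j_k, i_{k+1})`, alternating between agents and items,
with the marks of its edges (`i_a j_a` has mark `markF a` and `j_a i_{a+1}` has mark `markB a`).
Positions are counted from `0`. -/
structure AltWalk (N M : Type*) where
  k : ℕ
  agent : Fin (k + 1) → N
  item : Fin k → M
  markF : Fin k → Bool
  markB : Fin k → Bool

namespace AltWalk

variable {N M : Type*}

/-- The edge `i_a j_a`. -/
def fwd (W : AltWalk N M) (a : Fin W.k) : Edge N M := (W.agent a.castSucc, W.item a, W.markF a)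

/-- The edge `j_a i_{a+1}`. -/
def bwd (W : AltWalk N M) (a : Fin W.k) : Edge N M := (W.agent a.succ, W.item a, W.markB a)

/-- All edges of the walk lie in `F`. -/
def IsIn (W : AltWalk N M) (F : Set (Edge N M)) : Prop :=
  ∀ a, W.fwd a ∈ F ∧ W.bwd a ∈ F

/-- Simple cycles of marked edges. There are no parallel marked edges, so `k ≥ 2`. -/
structure IsMarkedCycle (W : AltWalk N M) : Prop where
  two_le : 2 ≤ W.k
  closed : W.agent (Fin.last W.k) = W.agent 0
  agent_inj : ∀ a b : Fin W.k, W.agent a.castSucc = W.agent b.castSucc → a = b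
  item_inj : ∀ a b : Fin W.k, W.item a = W.item b → a = b
  markF_eq : ∀ a, W.markF a = true
  markB_eq : ∀ a, W.markB a = true

/-- Pseudo-marked paths: the part `(j_1, i_2, …, i_k, j_k)` is a simple path of marked edges, and
the first edge `i_1 j_1` and the last edge `j_k i_{k+1}` are distinct unmarked edges. -/
structure IsPseudoMarkedPath (W : AltWalk N M) : Prop where
  one_le : 1 ≤ W.k
  item_inj : ∀ a b : Fin W.k, W.item a = W.item b → a = b
  agent_inj : ∀ a b : Fin (W.k + 1), a ≠ 0 → a ≠ Fin.last W.k → b ≠ 0 → b ≠ Fin.last W.k →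
    W.agent a = W.agent b → a = b
  markF_eq : ∀ a : Fin W.k, W.markF a = false ↔ a.val = 0
  markB_eq : ∀ a : Fin W.k, W.markB a = false ↔ a.val + 1 = W.k
  ends_ne : ∀ a b : Fin W.k, a.val = 0 → b.val + 1 = W.k → W.fwd a ≠ W.bwd b

/-- `δ₁ = min {min_a x(i_a j_a), min_a (1 - x(j_a i_{a+1}))}`. -/
noncomputable def delta₁ (W : AltWalk N M) (x : Edge N M → ℝ) : ℝ :=
  min (⨅ a, x (W.fwd a)) (⨅ a, (1 - x (W.bwd a)))

/-- `δ₂ = min {min_a (1 - x(i_a j_a)), min_a x(j_a i_{a+1})}`. -/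
noncomputable def delta₂ (W : AltWalk N M) (x : Edge N M → ℝ) : ℝ :=
  min (⨅ a, (1 - x (W.fwd a))) (⨅ a, x (W.bwd a))

/-- For every `a`, subtract `δ` from the value of `i_a j_a` and add `δ` to that of
`j_a i_{a+1}`. -/
def shift [DecidableEq N] [DecidableEq M] (W : AltWalk N M) (x : Edge N M → ℝ) (δ : ℝ) :
    Edge N M → ℝ :=
  x + ∑ a, (Pi.single (W.bwd a) δ - Pi.single (W.fwd a) δ)

end AltWalk

/-- `IsRoundingLaw E x μ`: `μ` is the law of the vector returned by an execution of the iterative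
rounding algorithm started at `x`. If `x` is integral, it is returned. Otherwise some marked cycle
or pseudo-marked path `W` of `G(x)` is picked; with probability `δ₂ / (δ₁ + δ₂)` the algorithm
continues from `W.shift x δ₁`, and with probability `δ₁ / (δ₁ + δ₂)` from `W.shift x (-δ₂)`.
The choice of `W` is arbitrary and may depend on everything that happened before. -/
inductive IsRoundingLaw {N M : Type*} [DecidableEq N] [DecidableEq M] (E : Set (Edge N M)) :
    (Edge N M → ℝ) → Measure (Edge N M → ℝ) → Prop
  | done (x : Edge N M → ℝ) (hx : fsupp E x = ∅) : IsRoundingLaw E x (Measure.dirac x)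
  | step (x : Edge N M → ℝ) (W : AltWalk N M) (hW : W.IsMarkedCycle ∨ W.IsPseudoMarkedPath)
      (hin : W.IsIn (fsupp E x)) (μ₁ μ₂ : Measure (Edge N M → ℝ))
      (h₁ : IsRoundingLaw E (W.shift x (W.delta₁ x)) μ₁)
      (h₂ : IsRoundingLaw E (W.shift x (-W.delta₂ x)) μ₂) :
      IsRoundingLaw E x
        (ENNReal.ofReal (W.delta₂ x / (W.delta₁ x + W.delta₂ x)) • μ₁ +
          ENNReal.ofReal (W.delta₁ x / (W.delta₁ x + W.delta₂ x)) • μ₂)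

open Classical in
/-- The set of items assigned to agent `i` by the (integral) vector `x`. -/
noncomputable def assigned {N M : Type*} [Fintype M] (E : Set (Edge N M)) (i : N)
    (x : Edge N M → ℝ) : Finset M :=
  {j | ∃ m : Bool, (i, j, m) ∈ E ∧ x (i, j, m) = 1}

end NSW

/-! Fix the agent and write f for its valuation, w for its row of `y`. The rounding preserves the
total value 1 of the marked edges at the agent, so it finally selects exactly one of them, leading
to some item j, and j has law `X j`. On the unmarked edges at the agent, each move changes at most
two items, in opposite directions. Along such directions the multilinear extension of a supermodular
function is concave, so its value is a supermartingale (`IsRoundingLaw.integral_multilinearExt_le`).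
No independence between marked and unmarked edges is available, and none is needed.

Let U be the set of items received along unmarked edges. The slack (1 - f(U)/T)⁺ is supermodular, so
its mean is at most its multilinear extension at `x*`. Adding items of the sets S \ {κ S} shrinks
the slack proportionally, which gives the bound exp(-rate(T)) (`multilinearExt_hinge_le`), where
rate(T) is the w-average of (f(S \ {κ S}) - T)⁺ / max(f{κ S}, T). By Markov, f(U) < T/e has
probability at most exp(-rate(T)) / (1 - 1/e).

Choose thresholds T_n at which the rate is n + 2, with T_n = 0 once the rate at 0 is at most n + 2.
Let n be the first index with f(U) ≥ T_n/e. For every S with κ S = j, replacing S \ {κ S} by U then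
costs at most 3 + n + exp(-(n+2)) (f(S \ {κ S}) - T_n)⁺ / max(f{j}, T_n) in the logarithm of the
maximum with f{j} (`log_max_le_sum`). Here n counts failed thresholds, hence is paid for by the tail
bounds. The last term, summed over all n, averages to at most Σ (n+2) exp(-(n+2)). These errors are
additive and hold pointwise, so only the marginal laws of j and of U enter. Both series together are
at most 26/e³ (`sum_errors_le`); ln 2 pays for splitting S into κ S and the rest. -/

namespace NSW

/-! ### Multilinear extensions: concavity along exchanges and exponential decay. -/

section Multilinear

variable {M : Type*} [DecidableEq M]

/-- The probability that the random set containing each `j ∈ s` independently with probability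
`p j` equals `R`. -/
noncomputable def prodWeight (s : Finset M) (p : M → ℝ) (R : Finset M) : ℝ :=
  ∏ j ∈ s, if j ∈ R then p j else 1 - p j

lemma prodWeight_nonneg {s : Finset M} {p : M → ℝ} (h0 : ∀ j, 0 ≤ p j) (h1 : ∀ j, p j ≤ 1)
    (R : Finset M) : 0 ≤ prodWeight s p R := by
  refine Finset.prod_nonneg fun j _ => ?_
  split_ifs
  · exact h0 j
  · linarith [h1 j]

lemma prodWeight_congr {s R R' : Finset M} {p p' : M → ℝ} (hp : ∀ j ∈ s, p j = p' j)
    (hR : ∀ j ∈ s, (j ∈ R ↔ j ∈ R')) : prodWeight s p R = prodWeight s p' R' := by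
  refine Finset.prod_congr rfl fun j hj => ?_
  simp only [hR j hj, hp j hj]

lemma prodWeight_eq_mul_erase {s : Finset M} {a : M} (ha : a ∈ s) (p : M → ℝ) (R : Finset M) :
    prodWeight s p R = (if a ∈ R then p a else 1 - p a) * prodWeight (s.erase a) p R := by
  rw [prodWeight, prodWeight, ← Finset.mul_prod_erase s _ ha]

lemma sum_powerset_prodWeight {s : Finset M} {a : M} (ha : a ∈ s) (ψ : Finset M → ℝ)
    (p : M → ℝ) :
    ∑ R ∈ s.powerset, prodWeight s p R * ψ R =
      ∑ R ∈ (s.erase a).powerset, prodWeight (s.erase a) p R *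
        ((1 - p a) * ψ R + p a * ψ (insert a R)) := by
  conv_lhs => rw [← Finset.insert_erase ha]
  rw [Finset.sum_powerset_insert (Finset.notMem_erase a s), ← Finset.sum_add_distrib]
  refine Finset.sum_congr rfl fun R hR => ?_
  have haR : a ∉ R := fun h => Finset.notMem_erase a s (Finset.mem_powerset.1 hR h)
  rw [Finset.insert_erase ha, prodWeight_eq_mul_erase ha, prodWeight_eq_mul_erase ha,
    prodWeight_congr (s := s.erase a) (R := insert a R) (R' := R) (p' := p) (fun _ _ => rfl)
      (fun j hj => by simp [Finset.ne_of_mem_erase hj])]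
  simp only [haR, if_false, Finset.mem_insert_self, if_true]
  ring

variable [Fintype M]

/-- The multilinear extension of a set function. -/
noncomputable def multilinearExt (ψ : Finset M → ℝ) (p : M → ℝ) : ℝ :=
  ∑ R : Finset M, prodWeight Finset.univ p R * ψ R

lemma multilinearExt_split (a : M) (ψ : Finset M → ℝ) (p : M → ℝ) :
    multilinearExt ψ p = ∑ R ∈ (Finset.univ.erase a).powerset,
      prodWeight (Finset.univ.erase a) p R * ((1 - p a) * ψ R + p a * ψ (insert a R)) := by
  rw [← sum_powerset_prodWeight (Finset.mem_univ a), multilinearExt, Finset.powerset_univ]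

lemma multilinearExt_split_two {a b : M} (hab : a ≠ b) (ψ : Finset M → ℝ) (p : M → ℝ) :
    multilinearExt ψ p = ∑ R ∈ ((Finset.univ.erase a).erase b).powerset,
      prodWeight ((Finset.univ.erase a).erase b) p R *
        ((1 - p b) * ((1 - p a) * ψ R + p a * ψ (insert a R)) +
          p b * ((1 - p a) * ψ (insert b R) + p a * ψ (insert a (insert b R)))) := by
  rw [multilinearExt_split a, sum_powerset_prodWeight (a := b) (by simp [hab.symm])
    (fun R => (1 - p a) * ψ R + p a * ψ (insert a R))]

lemma multilinearExt_of_indicator {ψ : Finset M → ℝ} {p : M → ℝ} {U : Finset M}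
    (h1 : ∀ j ∈ U, p j = 1) (h0 : ∀ j ∉ U, p j = 0) : multilinearExt ψ p = ψ U := by
  rw [multilinearExt, Finset.sum_eq_single U]
  · have : prodWeight Finset.univ p U = 1 := by
      refine Finset.prod_eq_one fun j _ => ?_
      split_ifs with h
      · exact h1 j h
      · rw [h0 j h, sub_zero]
    rw [this, one_mul]
  · intro R _ hR
    have : ∃ j, ¬(j ∈ R ↔ j ∈ U) := by
      by_contra! h
      exact hR (Finset.ext h)
    obtain ⟨j, hj⟩ := this
    rw [prodWeight, Finset.prod_eq_zero (Finset.mem_univ j), zero_mul]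
    by_cases hjR : j ∈ R
    · rw [if_pos hjR, h0 j (by tauto)]
    · rw [if_neg hjR, h1 j (by tauto), sub_self]
  · simp

/-- Directions with at most two non-zero coordinates, of opposite signs. -/
def IsExchange (d : M → ℝ) : Prop :=
  (∃ a, ∀ j, j ≠ a → d j = 0) ∨
    ∃ a b, a ≠ b ∧ d a * d b ≤ 0 ∧ ∀ j, j ≠ a → j ≠ b → d j = 0

/-- The multilinear extension of a supermodular function is concave along exchange directions. -/
lemma multilinearExt_exchange {ψ : Finset M → ℝ}
    (hψ : ∀ R a b, ψ (insert a R) + ψ (insert b R) ≤ ψ R + ψ (insert a (insert b R)))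
    {p d : M → ℝ} (h0 : ∀ j, 0 ≤ p j) (h1 : ∀ j, p j ≤ 1) (hd : IsExchange d)
    {c₁ c₂ δ₁ δ₂ : ℝ} (hc₁ : 0 ≤ c₁) (hc₂ : 0 ≤ c₂) (hc : c₁ + c₂ = 1)
    (hδ : c₁ * δ₁ = c₂ * δ₂) :
    c₁ * multilinearExt ψ (fun j => p j + δ₁ * d j) +
      c₂ * multilinearExt ψ (fun j => p j - δ₂ * d j) ≤ multilinearExt ψ p := by
  obtain rfl : c₂ = 1 - c₁ := by linarith
  rcases hd with ⟨a, ha⟩ | ⟨a, b, hab, hneg, hz⟩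
  · simp only [multilinearExt_split a]
    rw [Finset.mul_sum, Finset.mul_sum, ← Finset.sum_add_distrib]
    refine le_of_eq (Finset.sum_congr rfl fun R _ => ?_)
    rw [prodWeight_congr (s := Finset.univ.erase a) (p := fun j => p j + δ₁ * d j) (p' := p)
        (R' := R) (fun j hj => by simp [ha j (Finset.ne_of_mem_erase hj)]) (fun _ _ => Iff.rfl),
      prodWeight_congr (s := Finset.univ.erase a) (p := fun j => p j - δ₂ * d j) (p' := p)
        (R' := R) (fun j hj => by simp [ha j (Finset.ne_of_mem_erase hj)]) (fun _ _ => Iff.rfl)]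
    linear_combination (prodWeight (Finset.univ.erase a) p R * d a *
      (ψ (insert a R) - ψ R)) * hδ
  · simp only [multilinearExt_split_two hab]
    rw [Finset.mul_sum, Finset.mul_sum, ← Finset.sum_add_distrib]
    refine Finset.sum_le_sum fun R _ => ?_
    have hz' : ∀ j ∈ (Finset.univ.erase a).erase b, d j = 0 := fun j hj => by
      simp only [Finset.mem_erase, Finset.mem_univ, and_true] at hj
      exact hz j hj.2 hj.1
    rw [prodWeight_congr (s := (Finset.univ.erase a).erase b) (p := fun j => p j + δ₁ * d j)
        (p' := p) (R' := R) (fun j hj => by simp [hz' j hj]) (fun _ _ => Iff.rfl),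
      prodWeight_congr (s := (Finset.univ.erase a).erase b) (p := fun j => p j - δ₂ * d j)
        (p' := p) (R' := R) (fun j hj => by simp [hz' j hj]) (fun _ _ => Iff.rfl)]
    have hw := prodWeight_nonneg (s := (Finset.univ.erase a).erase b) h0 h1 R
    -- First-order terms cancel because the step has mean zero (`hδ`). What remains is the variance
    -- times `d a * d b ≤ 0` times the mixed second difference of `ψ`, which is nonnegative by
    -- supermodularity.
    have hq : 0 ≤ prodWeight ((Finset.univ.erase a).erase b) p R *
        (-(d a * d b) * (c₁ * δ₁ ^ 2 + (1 - c₁) * δ₂ ^ 2) *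
          (ψ R + ψ (insert a (insert b R)) - (ψ (insert a R) + ψ (insert b R)))) := by
      have := hψ R a b
      refine mul_nonneg hw (mul_nonneg (mul_nonneg (by linarith) (by positivity)) (by linarith))
    set w := prodWeight ((Finset.univ.erase a).erase b) p R
    refine le_of_sub_nonneg (hq.trans (le_of_eq ?_))
    linear_combination (w * (d b * ((1 - p a) * (ψ (insert b R) - ψ R) +
        p a * (ψ (insert a (insert b R)) - ψ (insert a R))) +
      d a * ((1 - p b) * (ψ (insert a R) - ψ R) +
        p b * (ψ (insert a (insert b R)) - ψ (insert b R))))) * hδ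

lemma hasDerivAt_prodWeight (p : M → ℝ) (R : Finset M) (t : ℝ) :
    HasDerivAt (fun t => prodWeight Finset.univ (fun j => t * p j) R)
      (∑ j, p j * ((if j ∈ R then 1 else -1) *
        prodWeight (Finset.univ.erase j) (fun j => t * p j) R)) t := by
  have h : ∀ j ∈ (Finset.univ : Finset M), HasDerivAt
      (fun t : ℝ => if j ∈ R then t * p j else 1 - t * p j) (if j ∈ R then p j else -p j) t := by
    intro j _
    have := (hasDerivAt_id t).mul_const (p j)
    split_ifs
    · simpa using this
    · simpa using this.const_sub 1
  have := HasDerivAt.fun_finsetProd h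
  refine this.congr_deriv (Finset.sum_congr rfl fun j _ => ?_)
  simp only [prodWeight, smul_eq_mul]
  split_ifs <;> ring

lemma hasDerivAt_multilinearExt (ψ : Finset M → ℝ) (p : M → ℝ) (t : ℝ) :
    HasDerivAt (fun t => multilinearExt ψ (fun j => t * p j))
      (∑ j, p j * ∑ R ∈ (Finset.univ.erase j).powerset,
        prodWeight (Finset.univ.erase j) (fun j => t * p j) R * (ψ (insert j R) - ψ R)) t := by
  have h := HasDerivAt.fun_sum (u := (Finset.univ : Finset (Finset M)))
    fun R _ => (hasDerivAt_prodWeight p R t).mul_const (ψ R)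
  refine h.congr_deriv ?_
  simp only [Finset.sum_mul]
  rw [Finset.sum_comm]
  refine Finset.sum_congr rfl fun j _ => ?_
  rw [Finset.mul_sum, ← Finset.powerset_univ]
  conv_lhs => rw [← Finset.insert_erase (Finset.mem_univ j)]
  rw [Finset.sum_powerset_insert (Finset.notMem_erase j _), ← Finset.sum_add_distrib]
  refine Finset.sum_congr rfl fun R hR => ?_
  have hjR : j ∉ R := fun h => Finset.notMem_erase j _ (Finset.mem_powerset.1 hR h)
  rw [Finset.insert_erase (Finset.mem_univ j),
    prodWeight_congr (s := Finset.univ.erase j) (R := insert j R) (R' := R)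
      (p' := fun j => t * p j) (fun _ _ => rfl)
      (fun j' hj => by simp [Finset.ne_of_mem_erase hj])]
  simp only [hjR, if_false, Finset.mem_insert_self, if_true]
  ring

/-- Exponential decay of the multilinear extension of a monotonically decreasing function whose
expected decrease is at least a fixed fraction of its value. -/
lemma multilinearExt_le_exp {ψ : Finset M → ℝ} (hanti : ∀ R j, ψ (insert j R) ≤ ψ R)
    {p : M → ℝ} (h0 : ∀ j, 0 ≤ p j) (h1 : ∀ j, p j ≤ 1) {c : ℝ}
    (hdec : ∀ R, c * ψ R ≤ ∑ j, p j * (ψ R - ψ (insert j R))) :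
    multilinearExt ψ p ≤ Real.exp (-c) * ψ ∅ := by
  set F : ℝ → ℝ := fun t => multilinearExt ψ (fun j => t * p j) with hF
  set F' : ℝ → ℝ := fun t => ∑ j, p j * ∑ R ∈ (Finset.univ.erase j).powerset,
        prodWeight (Finset.univ.erase j) (fun j => t * p j) R * (ψ (insert j R) - ψ R) with hF'
  have hder : ∀ t, HasDerivAt F (F' t) t := hasDerivAt_multilinearExt ψ p
  have hbound : ∀ t, 0 ≤ t → t ≤ 1 → F' t ≤ -c * F t := by
    intro t ht0 ht1
    have q0 : ∀ j, 0 ≤ t * p j := fun j => mul_nonneg ht0 (h0 j)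
    have q1 : ∀ j, t * p j ≤ 1 := fun j => mul_le_one₀ ht1 (h0 j) (h1 j)
    calc F' t ≤ ∑ j, p j * ∑ R : Finset M,
          prodWeight Finset.univ (fun j => t * p j) R * (ψ (insert j R) - ψ R) := by
          refine Finset.sum_le_sum fun j _ => mul_le_mul_of_nonneg_left ?_ (h0 j)
          have := multilinearExt_split j (fun R => ψ (insert j R) - ψ R) (fun j => t * p j)
          rw [multilinearExt] at this
          rw [this]
          refine Finset.sum_le_sum fun R _ =>
            mul_le_mul_of_nonneg_left ?_ (prodWeight_nonneg q0 q1 R)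
          -- Sets already containing `j` contribute nothing, so passing to the full sum multiplies
          -- the nonpositive difference by `1 - t * p j` and can only increase it.
          simp only [Finset.insert_idem, sub_self, mul_zero, add_zero]
          nlinarith [hanti R j, q0 j]
      _ = -∑ R : Finset M, prodWeight Finset.univ (fun j => t * p j) R *
            ∑ j, p j * (ψ R - ψ (insert j R)) := by
          simp only [Finset.mul_sum]
          rw [Finset.sum_comm, ← Finset.sum_neg_distrib]
          refine Finset.sum_congr rfl fun R _ => ?_
          rw [← Finset.sum_neg_distrib]
          exact Finset.sum_congr rfl fun j _ => by ring
      _ ≤ -c * F t := by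
          rw [neg_mul, neg_le_neg_iff, hF]
          simp only [multilinearExt]
          rw [Finset.mul_sum]
          refine Finset.sum_le_sum fun R _ => ?_
          have := mul_le_mul_of_nonneg_left (hdec R)
            (prodWeight_nonneg (s := Finset.univ) q0 q1 R)
          linarith
  -- Grönwall with the integrating factor `exp (c * t)`: the bound `F' ≤ -c F` makes the product
  -- antitone on `[0, 1]`.
  have hGder : ∀ t, HasDerivAt (fun t => Real.exp (c * t) * F t)
      (Real.exp (c * t) * (c * F t + F' t)) t := by
    intro t
    have h1 : HasDerivAt (fun t => Real.exp (c * t)) (Real.exp (c * t) * c) t := by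
      simpa using ((hasDerivAt_id t).const_mul c).exp
    exact (h1.mul (hder t)).congr_deriv (by ring)
  have hanti' : AntitoneOn (fun t => Real.exp (c * t) * F t) (Set.Icc 0 1) := by
    refine antitoneOn_of_deriv_nonpos (convex_Icc 0 1)
      (fun t _ => (hGder t).continuousAt.continuousWithinAt)
      (fun t _ => (hGder t).differentiableAt.differentiableWithinAt) fun t ht => ?_
    rw [interior_Icc] at ht
    rw [(hGder t).deriv]
    refine mul_nonpos_of_nonneg_of_nonpos (Real.exp_pos _).le ?_
    linarith [hbound t ht.1.le ht.2.le]
  have h01 := hanti' (Set.left_mem_Icc.2 zero_le_one) (Set.right_mem_Icc.2 zero_le_one) zero_le_one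
  have hF0 : F 0 = ψ ∅ := multilinearExt_of_indicator (by simp) (by simp)
  have hF1 : F 1 = multilinearExt ψ p := by simp [hF]
  simp only [mul_zero, mul_one, Real.exp_zero, one_mul, hF0, hF1] at h01
  rw [Real.exp_neg, ← div_eq_inv_mul, le_div_iff₀ (Real.exp_pos c)]
  linarith

end Multilinear

/-! ### Directions of the rounding moves along cycles and paths. -/

namespace AltWalk

variable {N M : Type*} {W : AltWalk N M}

lemma item_injective (hW : W.IsMarkedCycle ∨ W.IsPseudoMarkedPath) :
    Function.Injective W.item :=
  hW.elim (fun h a b => h.item_inj a b) fun h a b => h.item_inj a b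

lemma one_le_k (hW : W.IsMarkedCycle ∨ W.IsPseudoMarkedPath) : 1 ≤ W.k :=
  hW.elim (fun h => one_le_two.trans h.two_le) fun h => h.one_le

/-- Items are distinct along the walk, so a coincidence forces `a = b`. Consecutive agents of a
cycle differ since `k ≥ 2`; on a path a marked coincidence would repeat an interior agent, and an
unmarked one forces `k = 1` and contradicts `ends_ne`. Hence every edge of the walk moves by exactly
`±δ`. -/
lemma fwd_ne_bwd (hW : W.IsMarkedCycle ∨ W.IsPseudoMarkedPath) (a b : Fin W.k) :
    W.fwd a ≠ W.bwd b := by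
  intro h
  obtain rfl : a = b := item_injective hW (congrArg (fun e => e.2.1) h)
  have hag : W.agent a.castSucc = W.agent a.succ := congrArg (fun e => e.1) h
  have hmark : W.markF a = W.markB a := congrArg (fun e => e.2.2) h
  rcases hW with hW | hW
  · have hk := hW.two_le
    by_cases hlast : a.val + 1 < W.k
    · have hs : a.succ = (⟨a.val + 1, hlast⟩ : Fin W.k).castSucc := rfl
      rw [hs] at hag
      have := congrArg Fin.val (hW.agent_inj _ _ hag)
      simp at this
    · have ha := a.isLt
      have hs : a.succ = Fin.last W.k := Fin.ext (by simp only [Fin.val_succ, Fin.val_last]; omega)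
      have h0 : (0 : Fin (W.k + 1)) = (⟨0, by omega⟩ : Fin W.k).castSucc := rfl
      rw [hs, hW.closed, h0] at hag
      have := congrArg Fin.val (hW.agent_inj _ _ hag)
      simp only at this
      omega
  · by_cases hF : W.markF a = false
    · exact hW.ends_ne a a ((hW.markF_eq a).1 hF) ((hW.markB_eq a).1 (hmark ▸ hF)) h
    · have h0 : a.val ≠ 0 := fun h0 => hF ((hW.markF_eq a).2 h0)
      have h1 : a.val + 1 ≠ W.k := fun h1 => hF (hmark.trans ((hW.markB_eq a).2 h1))
      have ha := a.isLt
      have := hW.agent_inj a.castSucc a.succ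
        (fun h => h0 (by simpa using congrArg Fin.val h))
        (fun h => by have := congrArg Fin.val h; simp at this; omega)
        (Fin.succ_ne_zero a)
        (fun h => h1 (by simpa using congrArg Fin.val h)) hag
      have := congrArg Fin.val this
      simp at this

lemma delta₁_pos (hk : 1 ≤ W.k) {E : Set (Edge N M)} {x : Edge N M → ℝ}
    (hin : W.IsIn (fsupp E x)) : 0 < W.delta₁ x := by
  have : Nonempty (Fin W.k) := ⟨⟨0, hk⟩⟩
  obtain ⟨a, ha⟩ := exists_eq_ciInf_of_finite (f := fun a => x (W.fwd a))
  obtain ⟨b, hb⟩ := exists_eq_ciInf_of_finite (f := fun a => 1 - x (W.bwd a))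
  rw [delta₁, ← ha, ← hb]
  exact lt_min (hin a).1.2.1 (by linarith [(hin b).2.2.2])

lemma delta₂_pos (hk : 1 ≤ W.k) {E : Set (Edge N M)} {x : Edge N M → ℝ}
    (hin : W.IsIn (fsupp E x)) : 0 < W.delta₂ x := by
  have : Nonempty (Fin W.k) := ⟨⟨0, hk⟩⟩
  obtain ⟨a, ha⟩ := exists_eq_ciInf_of_finite (f := fun a => 1 - x (W.fwd a))
  obtain ⟨b, hb⟩ := exists_eq_ciInf_of_finite (f := fun a => x (W.bwd a))
  rw [delta₂, ← ha, ← hb]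
  exact lt_min (by linarith [(hin a).1.2.2]) (hin b).2.2.1

lemma delta₁_le (x : Edge N M → ℝ) (a : Fin W.k) :
    W.delta₁ x ≤ x (W.fwd a) ∧ W.delta₁ x ≤ 1 - x (W.bwd a) :=
  ⟨(min_le_left _ _).trans (ciInf_le (Set.finite_range _).bddBelow a),
    (min_le_right _ _).trans (ciInf_le (Set.finite_range _).bddBelow a)⟩

lemma delta₂_le (x : Edge N M → ℝ) (a : Fin W.k) :
    W.delta₂ x ≤ 1 - x (W.fwd a) ∧ W.delta₂ x ≤ x (W.bwd a) :=
  ⟨(min_le_left _ _).trans (ciInf_le (Set.finite_range _).bddBelow a),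
    (min_le_right _ _).trans (ciInf_le (Set.finite_range _).bddBelow a)⟩

variable [DecidableEq N] [DecidableEq M]

/-- The direction in which the rounding moves along the walk. -/
def dir (W : AltWalk N M) (e : Edge N M) : ℝ :=
  ∑ a, ((if W.bwd a = e then 1 else 0) - (if W.fwd a = e then 1 else 0))

lemma shift_apply (W : AltWalk N M) (x : Edge N M → ℝ) (δ : ℝ) (e : Edge N M) :
    W.shift x δ e = x e + δ * W.dir e := by
  simp only [shift, dir, Pi.add_apply, Finset.sum_apply, Pi.sub_apply, Pi.single_apply,
    Finset.mul_sum, mul_sub, mul_ite, mul_one, mul_zero, eq_comm (a := e)]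

lemma dir_bwd (hW : W.IsMarkedCycle ∨ W.IsPseudoMarkedPath) (a : Fin W.k) :
    W.dir (W.bwd a) = 1 := by
  rw [dir, Finset.sum_eq_single a]
  · simp [fwd_ne_bwd hW a a]
  · intro b _ hb
    have : W.bwd b ≠ W.bwd a := fun h => hb (item_injective hW (congrArg (fun e => e.2.1) h))
    simp [this, fwd_ne_bwd hW b a]
  · simp

lemma dir_fwd (hW : W.IsMarkedCycle ∨ W.IsPseudoMarkedPath) (a : Fin W.k) :
    W.dir (W.fwd a) = -1 := by
  rw [dir, Finset.sum_eq_single a]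
  · simp [(fwd_ne_bwd hW a a).symm]
  · intro b _ hb
    have : W.fwd b ≠ W.fwd a := fun h => hb (item_injective hW (congrArg (fun e => e.2.1) h))
    simp [this, (fwd_ne_bwd hW a b).symm]
  · simp

lemma dir_of_forall_ne {e : Edge N M} (hb : ∀ a, W.bwd a ≠ e) (hf : ∀ a, W.fwd a ≠ e) :
    W.dir e = 0 := by
  simp [dir, hb, hf]

/-- The rounding does not change the total value of the marked edges at an agent. -/
lemma sum_dir_marked [Fintype M] (hW : W.IsMarkedCycle ∨ W.IsPseudoMarkedPath) (i : N) :
    ∑ j, W.dir (i, j, true) = 0 := by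
  -- `c` marks the visits to `i` at which the walk enters and leaves by marked edges. The two ends
  -- of a path are excluded because their edges are unmarked, so the sum telescopes to `c (Fin.last
  -- W.k) - c 0 = 0`.
  obtain ⟨c, hB, hF, hc⟩ : ∃ c : Fin (W.k + 1) → ℝ,
      (∀ a : Fin W.k, c a.succ = if W.agent a.succ = i ∧ W.markB a = true then 1 else 0) ∧
      (∀ a : Fin W.k, c a.castSucc =
        if W.agent a.castSucc = i ∧ W.markF a = true then 1 else 0) ∧
      c (Fin.last W.k) = c 0 := by
    rcases hW with hW | hW
    · refine ⟨fun b => if W.agent b = i then 1 else 0, fun a => ?_, fun a => ?_, ?_⟩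
      · simp [hW.markB_eq a]
      · simp [hW.markF_eq a]
      · simp [hW.closed]
    · refine ⟨fun b => if W.agent b = i ∧ b ≠ 0 ∧ b ≠ Fin.last W.k then 1 else 0,
        fun a => ?_, fun a => ?_, by simp⟩
      · have : W.markB a = true ↔ a.succ ≠ Fin.last W.k := by
          rw [← Bool.not_eq_false, hW.markB_eq a, ne_eq, Fin.ext_iff]
          simp
        simp [this, Fin.succ_ne_zero]
      · have : W.markF a = true ↔ a.castSucc ≠ 0 := by
          rw [← Bool.not_eq_false, hW.markF_eq a, ne_eq, Fin.ext_iff]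
          simp
        simp [this, (Fin.castSucc_lt_last a).ne]
  have h1 : ∑ j, W.dir (i, j, true) = ∑ a : Fin W.k, (c a.succ - c a.castSucc) := by
    simp only [dir]
    rw [Finset.sum_comm]
    refine Finset.sum_congr rfl fun a _ => ?_
    rw [Finset.sum_sub_distrib, hB, hF]
    congr 1
    · rw [Finset.sum_eq_single (W.item a)]
      · simp [bwd]
      · intro b _ hb
        simp [bwd, hb.symm]
      · simp
    · rw [Finset.sum_eq_single (W.item a)]
      · simp [fwd]
      · intro b _ hb
        simp [fwd, hb.symm]
      · simp
  have h2 := Fin.sum_univ_succ c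
  have h3 := Fin.sum_univ_castSucc c
  rw [h1, Finset.sum_sub_distrib]
  linarith

/-- On the unmarked edges of an agent the rounding moves along an exchange direction. -/
lemma isExchange_dir (hW : W.IsMarkedCycle ∨ W.IsPseudoMarkedPath) (i : N) :
    IsExchange fun j => W.dir (i, j, false) := by
  have hk := one_le_k hW
  set a₀ : Fin W.k := ⟨0, hk⟩
  set a₁ : Fin W.k := ⟨W.k - 1, by omega⟩
  rcases hW with hW | hW
  · refine Or.inl ⟨W.item a₀, fun j _ => dir_of_forall_ne (fun a h => ?_) fun a h => ?_⟩
    · have := congrArg (fun e => e.2.2) h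
      simp [bwd, hW.markB_eq] at this
    · have := congrArg (fun e => e.2.2) h
      simp [fwd, hW.markF_eq] at this
  · have hF : ∀ a j, W.fwd a = (i, j, false) → a = a₀ := fun a j h =>
      Fin.ext ((hW.markF_eq a).1 (congrArg (fun e => e.2.2) h))
    have hB : ∀ a j, W.bwd a = (i, j, false) → a = a₁ := fun a j h => by
      have := (hW.markB_eq a).1 (congrArg (fun e => e.2.2) h)
      exact Fin.ext (by simp only [a₁]; omega)
    have hz : ∀ j, j ≠ W.item a₀ → j ≠ W.item a₁ → W.dir (i, j, false) = 0 := by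
      intro j h0 h1
      refine dir_of_forall_ne (fun a h => ?_) fun a h => ?_
      · obtain rfl := hB a j h
        exact h1 (congrArg (fun e => e.2.1) h).symm
      · obtain rfl := hF a j h
        exact h0 (congrArg (fun e => e.2.1) h).symm
    by_cases hne : W.item a₀ = W.item a₁
    · exact Or.inl ⟨W.item a₀, fun j hj => hz j hj (hne ▸ hj)⟩
    -- Unmarked values decrease only on the first edge and increase only on the last one, whence the
    -- opposite signs.
    · refine Or.inr ⟨W.item a₀, W.item a₁, hne, mul_nonpos_of_nonpos_of_nonneg ?_ ?_, hz⟩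
      · refine Finset.sum_nonpos fun a _ => ?_
        have : W.bwd a ≠ (i, W.item a₀, false) := fun h => by
          obtain rfl := hB a _ h
          exact hne (congrArg (fun e => e.2.1) h).symm
        rw [if_neg this]
        split_ifs <;> norm_num
      · refine Finset.sum_nonneg fun a _ => ?_
        have : W.fwd a ≠ (i, W.item a₁, false) := fun h => by
          obtain rfl := hF a _ h
          exact hne (congrArg (fun e => e.2.1) h)
        rw [if_neg this]
        split_ifs <;> norm_num

end AltWalk

/-! ### The law of the rounding: invariants, martingales and supermartingales. -/

section Law

variable {N M : Type*} [DecidableEq N] [DecidableEq M]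

lemma IsRoundingLaw.isProbabilityMeasure {E : Set (Edge N M)} {x : Edge N M → ℝ}
    {μ : Measure (Edge N M → ℝ)} (h : IsRoundingLaw E x μ) : IsProbabilityMeasure μ := by
  induction h with
  | done x hx => infer_instance
  | step x W hW hin μ₁ μ₂ h₁ h₂ ih₁ ih₂ =>
    have hp₁ := AltWalk.delta₁_pos (AltWalk.one_le_k hW) hin
    have hp₂ := AltWalk.delta₂_pos (AltWalk.one_le_k hW) hin
    constructor
    simp only [Measure.add_apply, Measure.smul_apply, measure_univ, smul_eq_mul, mul_one]
    rw [← ENNReal.ofReal_add (by positivity) (by positivity), ← add_div, add_comm,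
      div_self (by positivity), ENNReal.ofReal_one]

variable [Fintype M]

/-- The invariants of the rounding. -/
structure IsValid (E : Set (Edge N M)) (i : N) (x : Edge N M → ℝ) : Prop where
  eq_zero : ∀ e ∉ E, x e = 0
  nonneg : ∀ e, 0 ≤ x e
  le_one : ∀ e, x e ≤ 1
  sum_marked : ∑ j, x (i, j, true) = 1

lemma IsValid.shift {E : Set (Edge N M)} {i : N} {x : Edge N M → ℝ} (hx : IsValid E i x)
    {W : AltWalk N M} (hW : W.IsMarkedCycle ∨ W.IsPseudoMarkedPath) (hin : W.IsIn (fsupp E x))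
    {δ : ℝ} (hδF : ∀ a, 0 ≤ x (W.fwd a) - δ ∧ x (W.fwd a) - δ ≤ 1)
    (hδB : ∀ a, 0 ≤ x (W.bwd a) + δ ∧ x (W.bwd a) + δ ≤ 1) : IsValid E i (W.shift x δ) := by
  have key : ∀ e, 0 ≤ W.shift x δ e ∧ W.shift x δ e ≤ 1 := by
    intro e
    rw [W.shift_apply]
    by_cases hb : ∃ a, W.bwd a = e
    · obtain ⟨a, rfl⟩ := hb
      simpa [AltWalk.dir_bwd hW] using hδB a
    by_cases hf : ∃ a, W.fwd a = e
    · obtain ⟨a, rfl⟩ := hf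
      simpa [AltWalk.dir_fwd hW, sub_eq_add_neg] using hδF a
    push Not at hb hf
    simpa [AltWalk.dir_of_forall_ne hb hf] using ⟨hx.nonneg e, hx.le_one e⟩
  refine ⟨fun e he => ?_, fun e => (key e).1, fun e => (key e).2, ?_⟩
  · rw [W.shift_apply, AltWalk.dir_of_forall_ne, hx.eq_zero e he]
    · simp
    · rintro a rfl
      exact he (hin a).2.1
    · rintro a rfl
      exact he (hin a).1.1
  · simp only [W.shift_apply, Finset.sum_add_distrib, ← Finset.mul_sum,
      AltWalk.sum_dir_marked hW, hx.sum_marked]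
    simp

lemma IsValid.shift_delta₁ {E : Set (Edge N M)} {i : N} {x : Edge N M → ℝ} (hx : IsValid E i x)
    {W : AltWalk N M} (hW : W.IsMarkedCycle ∨ W.IsPseudoMarkedPath)
    (hin : W.IsIn (fsupp E x)) : IsValid E i (W.shift x (W.delta₁ x)) := by
  have hpos := AltWalk.delta₁_pos (AltWalk.one_le_k hW) hin
  refine hx.shift hW hin (fun a => ?_) fun a => ?_
  · constructor <;> linarith [(W.delta₁_le x a).1, hx.le_one (W.fwd a)]
  · constructor <;> linarith [(W.delta₁_le x a).2, hx.nonneg (W.bwd a)]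

lemma IsValid.shift_delta₂ {E : Set (Edge N M)} {i : N} {x : Edge N M → ℝ} (hx : IsValid E i x)
    {W : AltWalk N M} (hW : W.IsMarkedCycle ∨ W.IsPseudoMarkedPath)
    (hin : W.IsIn (fsupp E x)) : IsValid E i (W.shift x (-W.delta₂ x)) := by
  have hpos := AltWalk.delta₂_pos (AltWalk.one_le_k hW) hin
  refine hx.shift hW hin (fun a => ?_) fun a => ?_
  · constructor <;> linarith [(W.delta₂_le x a).1, hx.nonneg (W.fwd a)]
  · constructor <;> linarith [(W.delta₂_le x a).2, hx.le_one (W.bwd a)]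

variable [Fintype N]

/-- The law is a finite mixture of Dirac masses. -/
lemma IsRoundingLaw.integrable {E : Set (Edge N M)} {x : Edge N M → ℝ}
    {μ : Measure (Edge N M → ℝ)} (h : IsRoundingLaw E x μ) (g : (Edge N M → ℝ) → ℝ) :
    Integrable g μ := by
  induction h with
  | done x hx => exact integrable_dirac (by simp)
  | step x W hW hin μ₁ μ₂ h₁ h₂ ih₁ ih₂ =>
    exact (ih₁.smul_measure ENNReal.ofReal_ne_top).add_measure
      (ih₂.smul_measure ENNReal.ofReal_ne_top)

lemma IsRoundingLaw.ae_isValid {E : Set (Edge N M)} {x : Edge N M → ℝ}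
    {μ : Measure (Edge N M → ℝ)} (h : IsRoundingLaw E x μ) {i : N} (hx : IsValid E i x) :
    ∀ᵐ x ∂μ, IsValid E i x ∧ fsupp E x = ∅ := by
  induction h with
  | done x hx' =>
    rw [ae_dirac_eq]
    exact ⟨hx, hx'⟩
  | step x W hW hin μ₁ μ₂ h₁ h₂ ih₁ ih₂ =>
    rw [ae_add_measure_iff]
    exact ⟨Measure.ae_smul_measure (ih₁ (hx.shift_delta₁ hW hin)) _,
      Measure.ae_smul_measure (ih₂ (hx.shift_delta₂ hW hin)) _⟩

/-- Functions that do not increase in expectation in one step of the rounding. -/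
lemma IsRoundingLaw.integral_le {E : Set (Edge N M)} {x : Edge N M → ℝ}
    {μ : Measure (Edge N M → ℝ)} (h : IsRoundingLaw E x μ) {i : N} (hx : IsValid E i x)
    (g : (Edge N M → ℝ) → ℝ)
    (hg : ∀ (x : Edge N M → ℝ) (W : AltWalk N M), IsValid E i x →
      (W.IsMarkedCycle ∨ W.IsPseudoMarkedPath) → ∀ c₁ c₂ δ₁ δ₂ : ℝ, 0 ≤ c₁ → 0 ≤ c₂ →
      c₁ + c₂ = 1 → c₁ * δ₁ = c₂ * δ₂ →
      c₁ * g (W.shift x δ₁) + c₂ * g (W.shift x (-δ₂)) ≤ g x) :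
    ∫ x, g x ∂μ ≤ g x := by
  induction h with
  | done x hx' => rw [integral_dirac]
  | step x W hW hin μ₁ μ₂ h₁ h₂ ih₁ ih₂ =>
    have hp₁ := AltWalk.delta₁_pos (AltWalk.one_le_k hW) hin
    have hp₂ := AltWalk.delta₂_pos (AltWalk.one_le_k hW) hin
    rw [integral_add_measure ((h₁.integrable g).smul_measure ENNReal.ofReal_ne_top)
      ((h₂.integrable g).smul_measure ENNReal.ofReal_ne_top), integral_smul_measure,
      integral_smul_measure, ENNReal.toReal_ofReal (by positivity),
      ENNReal.toReal_ofReal (by positivity), smul_eq_mul, smul_eq_mul]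
    -- The branch probabilities are exactly those that give the move mean zero, which is the
    -- condition `c₁ * δ₁ = c₂ * δ₂`.
    refine le_trans (add_le_add
      (mul_le_mul_of_nonneg_left (ih₁ (hx.shift_delta₁ hW hin)) (by positivity))
      (mul_le_mul_of_nonneg_left (ih₂ (hx.shift_delta₂ hW hin)) (by positivity)))
      (hg x W hx hW _ _ _ _ (by positivity) (by positivity) ?_ ?_)
    · rw [← add_div, add_comm, div_self (by positivity)]
    · ring

/-- Each coordinate is a martingale, so equality holds; the one-sided form suffices since `H` may be
replaced by `-H`. -/
lemma IsRoundingLaw.integral_linear_le {E : Set (Edge N M)} {x : Edge N M → ℝ}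
    {μ : Measure (Edge N M → ℝ)} (h : IsRoundingLaw E x μ) {i : N} (hx : IsValid E i x)
    (H : M → ℝ) :
    ∫ x, ∑ j, x (i, j, true) * H j ∂μ ≤ ∑ j, x (i, j, true) * H j := by
  refine h.integral_le hx (fun x => ∑ j, x (i, j, true) * H j) ?_
  intro x W _ _ c₁ c₂ δ₁ δ₂ _ _ hc hδ
  simp only [W.shift_apply, Finset.mul_sum]
  rw [← Finset.sum_add_distrib]
  refine le_of_eq (Finset.sum_congr rfl fun j _ => ?_)
  linear_combination (x (i, j, true) * H j) * hc + (W.dir (i, j, true) * H j) * hδ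

/-- Negative correlation of the unmarked edges at an agent. -/
lemma IsRoundingLaw.integral_multilinearExt_le {E : Set (Edge N M)} {x : Edge N M → ℝ}
    {μ : Measure (Edge N M → ℝ)} (h : IsRoundingLaw E x μ) {i : N} (hx : IsValid E i x)
    {ψ : Finset M → ℝ}
    (hψ : ∀ R a b, ψ (insert a R) + ψ (insert b R) ≤ ψ R + ψ (insert a (insert b R))) :
    ∫ x, multilinearExt ψ (fun j => x (i, j, false)) ∂μ ≤
      multilinearExt ψ (fun j => x (i, j, false)) := by
  refine h.integral_le hx (fun x => multilinearExt ψ (fun j => x (i, j, false))) ?_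
  intro x W hx hW c₁ c₂ δ₁ δ₂ hc₁ hc₂ hc hδ
  simp only [W.shift_apply, neg_mul, ← sub_eq_add_neg]
  exact multilinearExt_exchange hψ (fun j => hx.nonneg _) (fun j => hx.le_one _)
    (AltWalk.isExchange_dir hW i) hc₁ hc₂ hc hδ

end Law

/-! ### Submodular values, truncated slack and the choice of thresholds. -/

section SetFunction

variable {M : Type*} [DecidableEq M] {f : Finset M → ℝ}

lemma MonotoneSubmodular.insert_sub_le (hf : MonotoneSubmodular f) (h0 : f ∅ = 0) (R : Finset M)
    (j : M) : f (insert j R) - f R ≤ f {j} := by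
  have h := hf.submodular {j} R
  have h' := hf.mono ∅ ({j} ∩ R) (Finset.empty_subset _)
  rw [← Finset.insert_eq] at h
  linarith

lemma MonotoneSubmodular.union_sub_le (hf : MonotoneSubmodular f) (R S : Finset M) :
    f (R ∪ S) - f R ≤ ∑ j ∈ S, (f (insert j R) - f R) := by
  induction S using Finset.induction_on with
  | empty => simp
  | insert a S ha ih =>
    rw [Finset.sum_insert ha]
    have h := hf.submodular (insert a R) (R ∪ S)
    have h1 : insert a R ∪ (R ∪ S) = R ∪ insert a S := by ext; simp
    have h2 := hf.mono R (insert a R ∩ (R ∪ S)) (Finset.subset_inter (Finset.subset_insert _ _)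
      Finset.subset_union_left)
    rw [h1] at h
    linarith

/-- The truncated slack `(1 - f R / T)⁺`. -/
noncomputable def hinge (f : Finset M → ℝ) (T : ℝ) (R : Finset M) : ℝ := max 0 (1 - f R / T)

lemma hinge_insert_le (hf : MonotoneSubmodular f) {T : ℝ} (hT : 0 < T) (R : Finset M) (j : M) :
    hinge f T (insert j R) ≤ hinge f T R := by
  have := hf.mono R (insert j R) (Finset.subset_insert _ _)
  unfold hinge
  gcongr

/-- A convex nonincreasing function of a monotone submodular function is supermodular; the
truncation splits this into linear cases. -/
lemma hinge_supermodular (hf : MonotoneSubmodular f) {T : ℝ} (hT : 0 < T) (R : Finset M)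
    (a b : M) : hinge f T (insert a R) + hinge f T (insert b R) ≤
      hinge f T R + hinge f T (insert a (insert b R)) := by
  have h := hf.submodular (insert a R) (insert b R)
  have h1 : insert a R ∪ insert b R = insert a (insert b R) := by ext; simp; tauto
  have h2 := hf.mono R (insert a R ∩ insert b R) (Finset.subset_inter (Finset.subset_insert _ _)
      (Finset.subset_insert _ _))
  rw [h1] at h
  have hab : f R + f (insert a (insert b R)) ≤ f (insert a R) + f (insert b R) := by linarith
  have ha := hf.mono R (insert a R) (Finset.subset_insert _ _)
  have hb := hf.mono R (insert b R) (Finset.subset_insert _ _)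
  replace hab := div_le_div_of_nonneg_right hab hT.le
  replace ha := div_le_div_of_nonneg_right ha hT.le
  replace hb := div_le_div_of_nonneg_right hb hT.le
  simp only [add_div] at hab
  unfold hinge
  rcases max_cases 0 (1 - f (insert a R) / T) with h3 | h3 <;>
  rcases max_cases 0 (1 - f (insert b R) / T) with h4 | h4 <;>
  linarith [le_max_left 0 (1 - f R / T), le_max_right 0 (1 - f R / T),
    le_max_left 0 (1 - f (insert a (insert b R)) / T),
    le_max_right 0 (1 - f (insert a (insert b R)) / T)]

/-- Adding a random item of `S` decreases the hinge by a fixed fraction. -/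
lemma hinge_decrease (hf : MonotoneSubmodular f) (h0 : f ∅ = 0) {T : ℝ} (hT : 0 < T)
    {S : Finset M} {k : ℝ} (hk : ∀ j ∈ S, f {j} ≤ k) (R : Finset M) :
    max 0 (f S - T) / max k T * hinge f T R ≤
      ∑ j ∈ S, (hinge f T R - hinge f T (insert j R)) := by
  have hK : 0 < max k T := lt_max_of_lt_right hT
  by_cases hR : T ≤ f R
  · have : hinge f T R = 0 := max_eq_left (by rw [sub_nonpos, le_div_iff₀ hT]; linarith)
    have hnn := Finset.sum_nonneg fun j (_ : j ∈ S) =>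
      sub_nonneg.2 (hinge_insert_le hf hT R j)
    calc _ = 0 := by rw [this, mul_zero]
      _ ≤ _ := hnn
  push Not at hR
  have hRnn := hf.nonneg R
  have hval : hinge f T R = (T - f R) / T := by
    rw [hinge, max_eq_right]
    · field_simp
    · rw [sub_nonneg, div_le_one hT]; exact hR.le
  have hψ : 0 ≤ hinge f T R := le_max_left _ _
  -- A gain `a` lowers the remaining gap `T - f R` by `a`, hence by at least the fraction `a / max k
  -- T`, as the gap is at most `T`. The `k` in the maximum keeps this fraction at most 1, which
  -- covers the case where the slack is truncated at 0.
  have hterm : ∀ j ∈ S, (f (insert j R) - f R) / max k T * hinge f T R ≤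
      hinge f T R - hinge f T (insert j R) := by
    intro j hj
    have ha0 : 0 ≤ f (insert j R) - f R :=
      sub_nonneg.2 (hf.mono _ _ (Finset.subset_insert _ _))
    have hak : f (insert j R) - f R ≤ max k T :=
      (hf.insert_sub_le h0 R j).trans ((hk j hj).trans (le_max_left _ _))
    have hfrac : (f (insert j R) - f R) / max k T ≤ 1 := (div_le_one hK).2 hak
    suffices hinge f T (insert j R) ≤
        (1 - (f (insert j R) - f R) / max k T) * hinge f T R by linarith
    refine max_le (mul_nonneg (by linarith) hψ) ?_
    have hle : (f (insert j R) - f R) / max k T * (T - f R) ≤ f (insert j R) - f R := by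
      rw [div_mul_eq_mul_div, div_le_iff₀ hK]
      exact mul_le_mul_of_nonneg_left (by linarith [le_max_right k T]) ha0
    rw [hval, ← mul_div_assoc, le_div_iff₀ hT, sub_mul, div_mul_cancel₀ _ hT.ne']
    linarith
  refine le_trans ?_ (Finset.sum_le_sum hterm)
  rw [← Finset.sum_mul, ← Finset.sum_div]
  refine mul_le_mul_of_nonneg_right (div_le_div_of_nonneg_right (max_le ?_ ?_) hK.le) hψ
  · exact Finset.sum_nonneg fun j _ => sub_nonneg.2 (hf.mono _ _ (Finset.subset_insert _ _))
  · have := hf.union_sub_le R S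
    have := hf.mono S (R ∪ S) Finset.subset_union_right
    linarith

/-- Subadditivity. It makes the largest item of a configuration valuable, so the single marked item
already keeps the logarithm's argument positive. -/
lemma MonotoneSubmodular.pos_of_pos (hf : MonotoneSubmodular f) (h0 : f ∅ = 0) {S : Finset M}
    (hS : 0 < f S) {k : ℝ} (hk : ∀ j ∈ S, f {j} ≤ k) : 0 < k := by
  by_contra! hk0
  have := hf.union_sub_le ∅ S
  rw [Finset.empty_union, h0, sub_zero] at this
  have h2 : ∑ j ∈ S, (f (insert j ∅) - 0) ≤ 0 := Finset.sum_nonpos fun j hj => by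
    rw [insert_empty_eq, sub_zero]
    exact (hk j hj).trans hk0
  linarith

variable [Fintype M]

/-- The exponential rate at which the unmarked items collected by the rounding reach the
value `T`. -/
noncomputable def rate (f : Finset M → ℝ) (w : Finset M → ℝ) (κ : Finset M → M) (T : ℝ) : ℝ :=
  ∑ S, w S * (max 0 (f (S \ {κ S}) - T) / max (f {κ S}) T)

variable {w : Finset M → ℝ} {κ : Finset M → M}

/-- Exchanging sums turns the expected decrease at the unmarked marginals into a `w`-average over
`S` of the decrease over `S \ {κ S}`, to which `hinge_decrease` applies; the slack of the empty set
is 1. -/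
lemma multilinearExt_hinge_le (hf : MonotoneSubmodular f) (h0 : f ∅ = 0) (hw : ∀ S, 0 ≤ w S)
    (hw1 : ∑ S, w S = 1) (hκ : ∀ S, 0 < w S → ∀ j ∈ S, f {j} ≤ f {κ S}) {T : ℝ} (hT : 0 < T) :
    multilinearExt (hinge f T) (fun j => ∑ S with j ∈ S \ {κ S}, w S) ≤
      Real.exp (-rate f w κ T) := by
  have h := multilinearExt_le_exp (ψ := hinge f T) (hinge_insert_le hf hT)
    (p := fun j => ∑ S with j ∈ S \ {κ S}, w S) (c := rate f w κ T)
    (fun j => Finset.sum_nonneg fun S _ => hw S)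
    (fun j => hw1 ▸ Finset.sum_le_univ_sum_of_nonneg hw) ?_
  · have : hinge f T ∅ = 1 := by simp [hinge, h0]
    rwa [this, mul_one] at h
  · intro R
    have hswap : ∑ j, (∑ S with j ∈ S \ {κ S}, w S) * (hinge f T R - hinge f T (insert j R)) =
        ∑ S, w S * ∑ j ∈ S \ {κ S}, (hinge f T R - hinge f T (insert j R)) := by
      simp only [Finset.sum_filter, Finset.sum_mul, Finset.mul_sum, ite_mul, zero_mul]
      rw [Finset.sum_comm]
      refine Finset.sum_congr rfl fun S _ => ?_
      rw [Finset.sum_ite_mem, Finset.univ_inter]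
    rw [hswap, rate, Finset.sum_mul]
    refine Finset.sum_le_sum fun S _ => ?_
    rcases (hw S).eq_or_lt with hS | hS
    · simp [← hS]
    · rw [mul_assoc]
      exact mul_le_mul_of_nonneg_left (hinge_decrease hf h0 hT
        (fun j hj => hκ S hS j (Finset.mem_sdiff.1 hj).1) R) hS.le

/-- The rate is continuous and vanishes for large `T`, so a level below its value at 0 is attained;
otherwise `T = 0` serves, and no lower bound on the rate is needed there. -/
lemma exists_threshold (hf : MonotoneSubmodular f) (hw : ∀ S, 0 ≤ w S)
    (hκ : ∀ S, 0 < w S → 0 < f {κ S}) {l : ℝ} (hl : 0 ≤ l) :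
    ∃ T, 0 ≤ T ∧ rate f w κ T ≤ l ∧ (0 < T → l ≤ rate f w κ T) ∧ (rate f w κ 0 ≤ l → T = 0) := by
  by_cases h : rate f w κ 0 ≤ l
  · exact ⟨0, le_rfl, h, fun h => absurd h (lt_irrefl _), fun _ => rfl⟩
  have hcont : Continuous (rate f w κ) := by
    refine continuous_finsetSum _ fun S _ => ?_
    rcases (hw S).eq_or_lt with hS | hS
    · simp only [← hS, zero_mul]
      exact continuous_const
    · refine continuous_const.mul (Continuous.div (by fun_prop) (by fun_prop) fun T => ?_)
      exact (lt_max_of_lt_left (hκ S hS)).ne'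
  set B : ℝ := ∑ S, f S
  have hB0 : 0 ≤ B := Finset.sum_nonneg fun S _ => hf.nonneg S
  have hB : rate f w κ B = 0 := Finset.sum_eq_zero fun S _ => by
    have : f (S \ {κ S}) ≤ B :=
      Finset.single_le_sum (f := f) (fun S _ => hf.nonneg S) (Finset.mem_univ _)
    rw [max_eq_left (by linarith)]
    simp
  push Not at h
  obtain ⟨T, hT, hTl⟩ := intermediate_value_Icc' hB0 hcont.continuousOn
    (show l ∈ Set.Icc (rate f w κ B) (rate f w κ 0) from ⟨hB.le.trans hl, h.le⟩)
  exact ⟨T, hT.1, hTl.le, fun _ => hTl.ge, fun h' => absurd h (not_lt.2 h')⟩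

end SetFunction

/-! ### Logarithmic inequalities and the numerical constant. -/

section Numeric

/-- Passing from `T` to `u ≥ T / e` costs 1. The rest is `log z ≤ z - 1` at `z = (V / max k T) * exp
(-b)`: the parameter `b` trades an additive loss against a small coefficient of the excess. -/
lemma log_max_le_of_threshold {k V u T : ℝ} (hk : 0 < k) (hu : T / Real.exp 1 ≤ u) {b : ℝ}
    (hb : 0 ≤ b) :
    Real.log (max k V) ≤
      Real.log (max k u) + 1 + b + Real.exp (-b) * (max 0 (V - T) / max k T) := by
  have hK : 0 < max k T := lt_max_of_lt_left hk
  have hU : 0 < max k u := lt_max_of_lt_left hk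
  have he : (1 : ℝ) ≤ Real.exp 1 := Real.one_le_exp zero_le_one
  have h1 : Real.log (max k T) ≤ Real.log (max k u) + 1 := by
    have h : Real.log (max k u) + 1 = Real.log (max k u * Real.exp 1) := by
      rw [Real.log_mul hU.ne' (Real.exp_pos 1).ne', Real.log_exp]
    rw [h]
    refine Real.log_le_log hK (max_le ?_ ?_)
    · nlinarith [le_max_left k u]
    · rw [div_le_iff₀ (Real.exp_pos 1)] at hu
      exact hu.trans (mul_le_mul_of_nonneg_right (le_max_right _ _) (Real.exp_pos 1).le)
  have hnn : 0 ≤ Real.exp (-b) * (max 0 (V - T) / max k T) :=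
    mul_nonneg (Real.exp_pos _).le (div_nonneg (le_max_left _ _) hK.le)
  rcases le_total V (max k T) with hV | hV
  · have := Real.log_le_log (lt_max_of_lt_left hk) (max_le (le_max_left k T) hV)
    linarith
  · have hV0 : 0 < V := hK.trans_le hV
    rw [max_eq_right ((le_max_left k T).trans hV)]
    have h2 : Real.log V ≤ Real.log (max k T) + b + Real.exp (-b) * ((V - max k T) / max k T) := by
      have h3 := Real.log_le_sub_one_of_pos
        (show 0 < V / max k T * Real.exp (-b) by positivity)
      rw [Real.log_mul (by positivity) (Real.exp_pos _).ne', Real.log_div hV0.ne' hK.ne',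
        Real.log_exp] at h3
      have h4 : Real.exp (-b) ≤ 1 := Real.exp_le_one_iff.2 (by linarith)
      rw [sub_div, div_self hK.ne']
      linarith
    have h5 : Real.exp (-b) * ((V - max k T) / max k T) ≤
        Real.exp (-b) * (max 0 (V - T) / max k T) := by
      refine mul_le_mul_of_nonneg_left (div_le_div_of_nonneg_right ?_ hK.le) (Real.exp_pos _).le
      exact le_max_of_le_right (by linarith [le_max_right k T])
    linarith

/-- Take the first `n` whose threshold is met, and `b = n + 2`. The loss `1 + b = 3 + n` is 3 plus
the number of failed thresholds; summing the excess over all indices removes the dependence of `n`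
on `u`. Since `T L = 0`, the search stops by `L`. -/
lemma log_max_le_sum {k V u : ℝ} (hk : 0 < k) (hu : 0 ≤ u) {T : ℕ → ℝ} {L : ℕ}
    (hL : T L = 0) :
    Real.log (max k V) ≤ Real.log (max k u) + 3 +
      ∑ n ∈ Finset.range L, (if u < T n / Real.exp 1 then 1 else 0) +
      ∑ n ∈ Finset.range (L + 1), Real.exp (-(n + 2)) * (max 0 (V - T n) / max k (T n)) := by
  have hex : ∃ n, T n / Real.exp 1 ≤ u := ⟨L, by rw [hL, zero_div]; exact hu⟩
  classical
  have hle : Nat.find hex ≤ L := Nat.find_min' hex (by rw [hL, zero_div]; exact hu)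
  have hmin : ∀ m < Nat.find hex, u < T m / Real.exp 1 :=
    fun m hm => not_le.1 (Nat.find_min hex hm)
  have hspec := Nat.find_spec hex
  generalize Nat.find hex = n at hle hmin hspec
  have h1 := log_max_le_of_threshold (V := V) hk hspec (b := n + 2) (by positivity)
  have h2 : (n : ℝ) ≤ ∑ n ∈ Finset.range L, (if u < T n / Real.exp 1 then (1 : ℝ) else 0) := by
    calc (n : ℝ) = ∑ m ∈ Finset.range n, (if u < T m / Real.exp 1 then (1 : ℝ) else 0) := by
          rw [Finset.sum_congr rfl fun m hm => if_pos (hmin m (Finset.mem_range.1 hm))]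
          simp
      _ ≤ _ := Finset.sum_le_sum_of_subset_of_nonneg (Finset.range_mono hle)
          fun m _ _ => by split_ifs <;> norm_num
  have h3 : Real.exp (-(n + 2)) * (max 0 (V - T n) / max k (T n)) ≤
      ∑ n ∈ Finset.range (L + 1), Real.exp (-(n + 2)) * (max 0 (V - T n) / max k (T n)) :=
    Finset.single_le_sum (f := fun n : ℕ =>
        Real.exp (-(n + 2)) * (max 0 (V - T n) / max k (T n)))
      (fun m _ => mul_nonneg (Real.exp_pos _).le
        (div_nonneg (le_max_left _ _) (hk.le.trans (le_max_left _ _))))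
      (Finset.mem_range.2 (by omega))
  linarith

lemma sum_range_pow_le {q : ℝ} (h0 : 0 ≤ q) (h1 : q < 1) (L : ℕ) :
    ∑ n ∈ Finset.range L, q ^ (n + 2) ≤ q ^ 2 / (1 - q) := by
  have h : ∑ n ∈ Finset.range L, q ^ (n + 2) = (q ^ 2 - q ^ (L + 2)) / (1 - q) := by
    have : 1 - q ≠ 0 := by linarith
    induction L with
    | zero => simp
    | succ L ih =>
      rw [Finset.sum_range_succ, ih]
      field_simp
      ring
  rw [h]
  exact div_le_div_of_nonneg_right (by linarith [pow_nonneg h0 (L + 2)]) (by linarith)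

lemma sum_range_mul_pow_le {q : ℝ} (h0 : 0 ≤ q) (h1 : q < 1) (L : ℕ) :
    ∑ n ∈ Finset.range L, ((n : ℝ) + 2) * q ^ (n + 2) ≤ q ^ 2 * (2 - q) / (1 - q) ^ 2 := by
  have h : ∑ n ∈ Finset.range L, ((n : ℝ) + 2) * q ^ (n + 2) =
      (q ^ 2 * (2 - q) - q ^ (L + 2) * ((L + 2) * (1 - q) + q)) / (1 - q) ^ 2 := by
    have : 1 - q ≠ 0 := by linarith
    induction L with
    | zero => rw [Finset.sum_range_zero, eq_comm, div_eq_zero_iff]; left; push_cast; ring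
    | succ L ih =>
      rw [Finset.sum_range_succ, ih]
      field_simp
      push_cast
      ring
  rw [h]
  refine div_le_div_of_nonneg_right ?_ (by positivity)
  have : 0 ≤ q ^ (L + 2) * ((L + 2) * (1 - q) + q) :=
    mul_nonneg (pow_nonneg h0 _) (add_nonneg (mul_nonneg (by positivity) (by linarith)) h0)
  linarith

/-- With `q = 1/e` both full series add up to `q² (3 - q) / (1 - q)²`, and `0.36 ≤ q ≤ 0.37`
suffices to compare this with `26 q³`. -/
lemma sum_errors_le (L : ℕ) :
    ∑ n ∈ Finset.range L, Real.exp (-((n : ℝ) + 2)) / (1 - Real.exp (-1)) +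
      ∑ n ∈ Finset.range (L + 1), ((n : ℝ) + 2) * Real.exp (-((n : ℝ) + 2)) ≤
        26 / Real.exp 3 := by
  have hq : ∀ n : ℕ, Real.exp (-((n : ℝ) + 2)) = Real.exp (-1) ^ (n + 2) := fun n => by
    rw [← Real.exp_nat_mul]
    push_cast
    ring_nf
  have h3 : 26 / Real.exp 3 = 26 * Real.exp (-1) ^ 3 := by
    rw [← Real.exp_nat_mul, div_eq_mul_inv, ← Real.exp_neg]
    norm_num
  simp only [hq, h3, ← Finset.sum_div]
  have hlo : (0.36 : ℝ) ≤ Real.exp (-1) := by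
    have := Real.exp_neg_one_gt_d9; linarith
  have hhi : Real.exp (-1) ≤ (0.37 : ℝ) := by
    have := Real.exp_neg_one_lt_d9; linarith
  generalize Real.exp (-1) = q at hlo hhi
  have h1 := sum_range_pow_le (q := q) (by linarith) (by linarith) L
  have h2 := sum_range_mul_pow_le (q := q) (by linarith) (by linarith) (L + 1)
  have hq1 : 0 < 1 - q := by linarith
  calc _ ≤ q ^ 2 / (1 - q) / (1 - q) + q ^ 2 * (2 - q) / (1 - q) ^ 2 :=
        add_le_add (div_le_div_of_nonneg_right h1 hq1.le) h2
    _ = q ^ 2 * ((3 - q) / (1 - q) ^ 2) := by field_simp; ring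
    _ ≤ q ^ 2 * (26 * q) := by
        refine mul_le_mul_of_nonneg_left ?_ (by positivity)
        rw [div_le_iff₀ (by positivity)]
        have : (0.39 : ℝ) ≤ (1 - q) ^ 2 := by nlinarith
        nlinarith
    _ = 26 * q ^ 3 := by ring

end Numeric

/-! ### Integral outcomes at the agent and the lower tail of the unmarked value. -/

section Main

variable {N M : Type*} [Fintype M]

lemma IsValid.eq_zero_or_one {E : Set (Edge N M)} {i : N} {x : Edge N M → ℝ}
    (hx : IsValid E i x) (hE : fsupp E x = ∅) (e : Edge N M) : x e = 0 ∨ x e = 1 := by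
  by_cases he : e ∈ E
  · by_contra! h
    have : e ∈ fsupp E x := ⟨he, (hx.nonneg e).lt_of_ne' h.1, (hx.le_one e).lt_of_ne h.2⟩
    rw [hE] at this
    exact this
  · exact Or.inl (hx.eq_zero e he)

open Classical in
/-- The items that an integral vector assigns to agent `i` along unmarked edges. -/
noncomputable def assignedUnmarked (i : N) (x : Edge N M → ℝ) : Finset M :=
  {j | x (i, j, false) = 1}

lemma IsValid.assignedUnmarked_subset {E : Set (Edge N M)} {i : N} {x : Edge N M → ℝ}
    (hx : IsValid E i x) : assignedUnmarked i x ⊆ assigned E i x := by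
  intro j hj
  simp only [assignedUnmarked, assigned, Finset.mem_filter, Finset.mem_univ, true_and] at hj ⊢
  refine ⟨false, by_contra fun h => ?_, hj⟩
  rw [hx.eq_zero _ h] at hj
  exact zero_ne_one hj

variable [DecidableEq M]

lemma isValid_xStar {y : N → Finset M → ℝ} (hy0 : ∀ i S, 0 ≤ y i S)
    (hy1 : ∀ i, ∑ S, y i S = 1) (κ : N → Finset M → M) (i : N) :
    IsValid (edgeSet y κ) i (xStar y κ) where
  eq_zero := by
    rintro ⟨i, j, m⟩ he
    cases m
    · refine Finset.sum_eq_zero fun S hS => ?_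
      by_contra hne
      exact he (Or.inr ⟨rfl, S, (hy0 i S).lt_of_ne' hne, (Finset.mem_filter.1 hS).2⟩)
    · refine Finset.sum_eq_zero fun S hS => ?_
      by_contra hne
      exact he (Or.inl ⟨rfl, S, (hy0 i S).lt_of_ne' hne, (Finset.mem_filter.1 hS).2.symm⟩)
  nonneg := by
    rintro ⟨i, j, _ | _⟩ <;> exact Finset.sum_nonneg fun S _ => hy0 i S
  le_one := by
    rintro ⟨i, j, _ | _⟩ <;> exact hy1 i ▸ Finset.sum_le_univ_sum_of_nonneg (hy0 i)
  sum_marked := by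
    rw [← hy1 i]
    exact Finset.sum_fiberwise Finset.univ (κ i) (y i)

/-- An integral vector selects exactly one marked edge at the agent. -/
lemma IsValid.exists_marked {E : Set (Edge N M)} {i : N} {x : Edge N M → ℝ}
    (hx : IsValid E i x) (hE : fsupp E x = ∅) :
    ∃ j, (i, j, true) ∈ E ∧ x (i, j, true) = 1 ∧
      ∀ H : M → ℝ, ∑ j', x (i, j', true) * H j' = H j := by
  obtain ⟨j, -, hj⟩ : ∃ j ∈ Finset.univ, x (i, j, true) ≠ 0 :=
    Finset.exists_ne_zero_of_sum_ne_zero (by rw [hx.sum_marked]; exact one_ne_zero)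
  have hj1 := (hx.eq_zero_or_one hE (i, j, true)).resolve_left hj
  have hsum := hx.sum_marked
  rw [← Finset.add_sum_erase _ _ (Finset.mem_univ j), hj1, add_eq_left,
    Finset.sum_eq_zero_iff_of_nonneg fun _ _ => hx.nonneg _] at hsum
  refine ⟨j, by_contra fun h => hj (hx.eq_zero _ h), hj1, fun H => ?_⟩
  rw [Finset.sum_eq_single j, hj1, one_mul]
  · intro j' _ hne
    rw [hsum j' (by simp [hne]), zero_mul]
  · simp

lemma IsValid.multilinearExt_eq {E : Set (Edge N M)} {i : N} {x : Edge N M → ℝ}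
    (hx : IsValid E i x) (hE : fsupp E x = ∅) (ψ : Finset M → ℝ) :
    multilinearExt ψ (fun j => x (i, j, false)) = ψ (assignedUnmarked i x) := by
  refine multilinearExt_of_indicator (fun j hj => ?_) fun j hj => ?_
  · simpa [assignedUnmarked] using hj
  · exact (hx.eq_zero_or_one hE _).resolve_right (by simpa [assignedUnmarked] using hj)

variable [DecidableEq N] [Fintype N]

/-- Lower tail of the value of the unmarked items. -/
lemma IsRoundingLaw.integral_tail_le {E : Set (Edge N M)} {x : Edge N M → ℝ}
    {μ : Measure (Edge N M → ℝ)} (h : IsRoundingLaw E x μ) {i : N} (hx : IsValid E i x)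
    {f : Finset M → ℝ} (hf : MonotoneSubmodular f) {T : ℝ} (hT : 0 < T) :
    ∫ x, (if f (assignedUnmarked i x) < T / Real.exp 1 then (1 : ℝ) else 0) ∂μ ≤
      multilinearExt (hinge f T) (fun j => x (i, j, false)) / (1 - Real.exp (-1)) := by
  have hq : 0 < 1 - Real.exp (-1) := by
    rw [sub_pos, Real.exp_lt_one_iff]
    norm_num
  refine le_trans ?_ (div_le_div_of_nonneg_right
    (h.integral_multilinearExt_le hx (hinge_supermodular hf hT)) hq.le)
  rw [← integral_div]
  refine integral_mono_ae (h.integrable _) (h.integrable _) ?_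
  filter_upwards [h.ae_isValid hx] with z hz
  rw [hz.1.multilinearExt_eq hz.2]
  split_ifs with hlt
  -- Markov: a value below `T / e` leaves slack at least `1 - 1/e`.
  · rw [le_div_iff₀ hq, one_mul]
    refine le_max_of_le_right (sub_le_sub_left ?_ 1)
    rw [div_le_iff₀ hT, Real.exp_neg, mul_comm, ← div_eq_mul_inv]
    exact hlt.le
  · exact div_nonneg (le_max_left _ _) hq.le

end Main

end NSW

/-! ### Assembly of the logarithmic bound. -/

theorem mainTheorem3 {N M : Type*} [Fintype N] [Fintype M] [DecidableEq N] [DecidableEq M]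
    (v : N → Finset M → ℝ)
    (hv : ∀ i, NSW.MonotoneSubmodular (v i)) (hv0 : ∀ i, v i ∅ = 0)
    (y : N → Finset M → ℝ) (hy : NSW.ConfLPFeasible y)
    (κ : N → Finset M → M) (hκ : NSW.IsLargestItem v y κ)
    (μ : MeasureTheory.Measure (NSW.Edge N M → ℝ))
    (hμ : NSW.IsRoundingLaw (NSW.edgeSet y κ) (NSW.xStar y κ) μ)
    (i : N) (hpos : ∀ S, 0 < y i S → 0 < v i S) :
    (∀ᵐ x ∂μ, 0 < v i (NSW.assigned (NSW.edgeSet y κ) i x)) ∧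
    MeasureTheory.Integrable
      (fun x => Real.log (v i (NSW.assigned (NSW.edgeSet y κ) i x))) μ ∧
    ∑ S : Finset M, y i S * Real.log (v i S) - (3 + 26 / Real.exp 3 + Real.log 2) ≤
      ∫ x, Real.log (v i (NSW.assigned (NSW.edgeSet y κ) i x)) ∂μ := by
  have hprob := hμ.isProbabilityMeasure
  have hvalid := NSW.isValid_xStar hy.nonneg hy.agent κ i
  have hae := hμ.ae_isValid hvalid
  have hk : ∀ S, 0 < y i S → 0 < v i {κ i S} := fun S hS =>
    (hv i).pos_of_pos (hv0 i) (hpos S hS) (hκ i S hS).2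
  have hmarked : ∀ x j, (i, j, true) ∈ NSW.edgeSet y κ → x (i, j, true) = 1 →
      {j} ⊆ NSW.assigned (NSW.edgeSet y κ) i x := fun x j hE hj => by
    simp only [Finset.singleton_subset_iff, NSW.assigned, Finset.mem_filter, Finset.mem_univ,
      true_and]
    exact ⟨true, hE, hj⟩
  have hlarge : ∀ j, (i, j, true) ∈ NSW.edgeSet y κ → ∃ S, 0 < y i S ∧ j = κ i S := by
    rintro j (h | h)
    · exact h.2
    · exact absurd h.1 (by simp)
  refine ⟨?_, hμ.integrable _, ?_⟩
  · filter_upwards [hae] with x hx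
    obtain ⟨j, hE, hj, -⟩ := hx.1.exists_marked hx.2
    obtain ⟨S, hS, rfl⟩ := hlarge j hE
    exact (hk S hS).trans_le ((hv i).mono _ _ (hmarked x _ hE hj))
  choose T hT0 hTle hTge hTzero using fun n : ℕ => NSW.exists_threshold (hv i)
    (hy.nonneg i) hk (l := (n : ℝ) + 2) (by positivity)
  -- Once `L + 2` exceeds the rate at 0 the threshold is 0, so finitely many indices suffice.
  obtain ⟨L, hL⟩ := exists_nat_ge (NSW.rate (v i) (y i) (κ i) 0)
  have hTL : T L = 0 := hTzero L (by linarith)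
  set g : Finset M → ℝ := fun S => ∑ n ∈ Finset.range (L + 1), Real.exp (-((n : ℝ) + 2)) *
    (max 0 (v i (S \ {κ i S}) - T n) / max (v i {κ i S}) (T n)) with hg
  set h : Finset M → ℝ :=
    fun S => Real.log (max (v i {κ i S}) (v i (S \ {κ i S}))) - g S with hh
  set X : M → ℝ := fun j => ∑ S with κ i S = j, y i S with hX
  -- The mean of `h` over configurations with largest item `j`, weighted by `y i`; thus the random
  -- marked item has expected `H` equal to the `y i`-average of `h`.
  set H : M → ℝ := fun j => (∑ S with κ i S = j, y i S * h S) / X j with hH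
  set tail : ℕ → (NSW.Edge N M → ℝ) → ℝ := fun n x =>
    if v i (NSW.assignedUnmarked i x) < T n / Real.exp 1 then 1 else 0 with htail
  have hpoint : ∀ᵐ x ∂μ, ∑ j, x (i, j, true) * H j - 3 - ∑ n ∈ Finset.range L, tail n x ≤
      Real.log (v i (NSW.assigned (NSW.edgeSet y κ) i x)) := by
    filter_upwards [hae] with x hx
    obtain ⟨j, hE, hj, hsum⟩ := hx.1.exists_marked hx.2
    obtain ⟨S₀, hS₀, hjS₀⟩ := hlarge j hE
    have hkj : 0 < v i {j} := hjS₀ ▸ hk S₀ hS₀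
    have hXj : 0 < X j := hS₀.trans_le (Finset.single_le_sum (f := y i)
      (fun S _ => hy.nonneg i S) (by simp [hjS₀]))
    have hlog : Real.log (max (v i {j}) (v i (NSW.assignedUnmarked i x))) ≤
        Real.log (v i (NSW.assigned (NSW.edgeSet y κ) i x)) :=
      Real.log_le_log (lt_max_of_lt_left hkj) (max_le ((hv i).mono _ _ (hmarked x j hE hj))
        ((hv i).mono _ _ hx.1.assignedUnmarked_subset))
    rw [hsum]
    suffices H j ≤ Real.log (max (v i {j}) (v i (NSW.assignedUnmarked i x))) + 3 +
        ∑ n ∈ Finset.range L, tail n x by linarith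
    rw [hH]
    simp only
    -- The bound holds for every `S` with `κ i S = j` against the same outcome, so it may be
    -- averaged over these `S`; this is where correlation with the unmarked items becomes
    -- irrelevant.
    rw [div_le_iff₀ hXj, mul_comm, hX, Finset.sum_mul]
    refine Finset.sum_le_sum fun S hS => ?_
    have hSj : κ i S = j := (Finset.mem_filter.1 hS).2
    refine mul_le_mul_of_nonneg_left ?_ (hy.nonneg i S)
    have := NSW.log_max_le_sum (V := v i (S \ {κ i S})) hkj
      ((hv i).nonneg (NSW.assignedUnmarked i x)) hTL
    simp only [hh, hg, htail, hSj] at this ⊢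
    linarith
  have hlin : ∑ S, y i S * h S ≤ ∫ x, ∑ j, x (i, j, true) * H j ∂μ := by
    have h1 := hμ.integral_linear_le hvalid (fun j => -H j)
    simp only [mul_neg, Finset.sum_neg_distrib, integral_neg, neg_le_neg_iff] at h1
    refine le_trans (le_of_eq ?_) h1
    rw [← Finset.sum_fiberwise Finset.univ (κ i)]
    refine Finset.sum_congr rfl fun j _ => ?_
    change _ = X j * H j
    -- If `X j = 0`, all weights in the fibre vanish, so the value of the quotient `H j` is
    -- immaterial.
    by_cases hXj : X j = 0
    · rw [hXj, zero_mul]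
      refine Finset.sum_eq_zero fun S hS => ?_
      rw [(Finset.sum_eq_zero_iff_of_nonneg fun S _ => hy.nonneg i S).1 hXj S hS, zero_mul]
    · rw [hH, mul_div_cancel₀ _ hXj]
  have htail_le : ∀ n, ∫ x, tail n x ∂μ ≤ Real.exp (-((n : ℝ) + 2)) / (1 - Real.exp (-1)) := by
    intro n
    have hq : 0 < 1 - Real.exp (-1) := by
      rw [sub_pos, Real.exp_lt_one_iff]
      norm_num
    -- At threshold 0 the tail event is empty; this is the case in which the rate may be smaller
    -- than `n + 2`.
    rcases (hT0 n).eq_or_lt with hn | hn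
    · have : ∀ x, tail n x = 0 := fun x => by
        simp only [htail, ← hn, zero_div]
        exact if_neg (not_lt.2 ((hv i).nonneg _))
      simp only [this, integral_zero]
      positivity
    · refine (hμ.integral_tail_le hvalid (hv i) hn).trans
        (div_le_div_of_nonneg_right ?_ hq.le)
      refine (NSW.multilinearExt_hinge_le (hv i) (hv0 i) (hy.nonneg i) (hy.agent i)
        (fun S hS => (hκ i S hS).2) hn).trans (Real.exp_le_exp.2 ?_)
      linarith [hTge n hn]
  have hgsum : ∑ S, y i S * g S ≤
      ∑ n ∈ Finset.range (L + 1), ((n : ℝ) + 2) * Real.exp (-((n : ℝ) + 2)) := by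
    simp only [hg, Finset.mul_sum]
    rw [Finset.sum_comm]
    refine Finset.sum_le_sum fun n _ => ?_
    -- Averaging the `n`-th excess over the configurations produces exactly the rate at `T n`, which
    -- is at most `n + 2`.
    refine le_trans (le_of_eq ?_) (mul_le_mul_of_nonneg_right (hTle n) (Real.exp_pos _).le)
    rw [NSW.rate, Finset.sum_mul]
    exact Finset.sum_congr rfl fun S _ => by ring
  have hlogS : ∑ S, y i S * Real.log (v i S) ≤
      ∑ S, y i S * h S + ∑ S, y i S * g S + Real.log 2 := by
    have hone : Real.log 2 = ∑ S, y i S * Real.log 2 := by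
      rw [← Finset.sum_mul, hy.agent i, one_mul]
    rw [hone, ← Finset.sum_add_distrib, ← Finset.sum_add_distrib]
    refine Finset.sum_le_sum fun S _ => ?_
    rcases (hy.nonneg i S).eq_or_lt with hS | hS
    · simp [← hS]
    have hm : 0 < max (v i {κ i S}) (v i (S \ {κ i S})) := lt_max_of_lt_left (hk S hS)
    -- Subadditivity bounds `v i S` by the sum of its two parts, hence by twice the larger one: the
    -- source of `log 2`.
    have hle : v i S ≤ max (v i {κ i S}) (v i (S \ {κ i S})) * 2 := by
      have h1 := (hv i).submodular {κ i S} (S \ {κ i S})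
      rw [Finset.union_sdiff_of_subset (Finset.singleton_subset_iff.2 (hκ i S hS).1)] at h1
      have h2 := (hv i).nonneg ({κ i S} ∩ (S \ {κ i S}))
      linarith [le_max_left (v i {κ i S}) (v i (S \ {κ i S})),
        le_max_right (v i {κ i S}) (v i (S \ {κ i S}))]
    have := Real.log_le_log (hpos S hS) hle
    rw [Real.log_mul hm.ne' two_ne_zero] at this
    rw [← mul_add, ← mul_add]
    refine mul_le_mul_of_nonneg_left ?_ hS.le
    simp only [hh]
    linarith
  have hint := integral_mono_ae (hμ.integrable _) (hμ.integrable _) hpoint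
  rw [integral_sub (hμ.integrable _) (hμ.integrable _),
    integral_sub (hμ.integrable _) (hμ.integrable _),
    integral_finsetSum (Finset.range L) fun n _ => hμ.integrable _, integral_const, probReal_univ,
    one_smul] at hint
  have hsumtail := Finset.sum_le_sum fun n (_ : n ∈ Finset.range L) => htail_le n
  have herr := NSW.sum_errors_le L
  linarith
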